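/- For subsets $A,B$ of a finite abelian group $G$ (written additively), let $\Delta(A,B)$ be the multiset $\{x-y : x\in A,\ y\in B\}$. A $k$-subset $D$ of a group $G$ of order $v$ is a $(v,k,\lambda)$-difference set, where $\lambda\ge 1$, if $\Delta(D,D)$ consists of $k$ copies of $0$ and $\lambda$ copies of each nonzero element of $G$. Pairwise disjoint subsets $D_1,\dots,D_m$ of an abelian group $G$ of order $v$ with $|D_i|=k_i$ form a $(v,m;k_1,\dots,k_m;\lambda_1,\dots,\lambda_m)$-GSEDF (generalized strong external difference family) in $G$, where the $\lambda_i$ are positive integers, if for every $i$ the multiset union $\bigcup_{j\ne i}\Delta(D_i,D_j)$ (adding multiplicities) consists of exactly $\lambda_i$ copies of each nonzero element of $G$. **Theorem.** Let $q$ and $q+2$ be odd prime powers and $v=q(q+2)$. Then $4\mid v+1$, and a $\left(v,2;\frac{v-1}2,\frac{v+1}2;\frac{v+1}4,\frac{v+1}4\right)$-GSEDF exists. More precisely, for all finite fields $\mathbb F_q$ and $\mathbb F_{q+2}$ of orders $q$ and $q+2$, the twin-prime-power set $$D=\{(x,0): x\in\mathbb F_q\}\cup\{(x,y): x\in\mathbb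 F_q\setminus\{0\},\ y\in\mathbb F_{q+2}\setminus\{0\},\ x\text{ and }y\text{ are both squares or both nonsquares}\}$$ is a $\left(v,\frac{v-1}2,\frac{v-3}4\right)$-difference set in the additive group $G=\mathbb F_q\times\mathbb F_{q+2}$, and $\{D,\,G\setminus D\}$ (in this order) is a $\left(v,2;\frac{v-1}2,\frac{v+1}2;\frac{v+1}4,\frac{v+1}4\right)$-GSEDF in $G$. -/

import Mathlib

/-- The multiset of differences `x - y` with `x ∈ A` and `y ∈ B`, counted with multiplicity. -/
def diffMultiset {G : Type*} [AddCommGroup G] (A B : Finset G) : Multiset G :=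
  (A ×ˢ B).val.map fun p => p.1 - p.2

/-- `D` is a `(v, k, lam)`-difference set in the finite abelian group `G`: `G` has order `v`,
`D` has `k` elements, `lam` is positive, and the multiset of differences of `D` consists of
`k` copies of `0` and `lam` copies of every nonzero element of `G`. -/
def IsDifferenceSet {G : Type*} [AddCommGroup G] [Fintype G] [DecidableEq G]
    (v k lam : ℕ) (D : Finset G) : Prop :=
  Fintype.card G = v ∧ D.card = k ∧ 0 < lam ∧
    diffMultiset D D = k • ({0} : Multiset G) + lam • ((Finset.univ : Finset G) \ {0}).val

/-- The family `D` is a `(v, m; k_1, …, k_m; lam_1, …, lam_m)`-generalized strong external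
difference family in the finite abelian group `G`. Unions of multisets add multiplicities. -/
def IsGSEDF {G : Type*} [AddCommGroup G] [Fintype G] [DecidableEq G]
    (v m : ℕ) (k lam : Fin m → ℕ) (D : Fin m → Finset G) : Prop :=
  Fintype.card G = v ∧
  (∀ i, 0 < lam i) ∧
  (∀ i j, i ≠ j → Disjoint (D i) (D j)) ∧
  (∀ i, (D i).card = k i) ∧
  ∀ i, ∑ j ∈ Finset.univ.filter (fun j => j ≠ i), diffMultiset (D i) (D j) =
    lam i • ((Finset.univ : Finset G) \ {0}).val

/-- The twin-prime-power set in `F × K`, for finite fields `F` and `K` (of orders `q` and `q + 2`):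
all pairs `(x, 0)`, and all pairs `(x, y)` of nonzero elements such that `x` and `y` are both
squares or both nonsquares. -/
def twinPrimePowerSet (F K : Type*) [Field F] [Fintype F] [DecidableEq F]
    [Field K] [Fintype K] [DecidableEq K] : Finset (F × K) :=
  Finset.univ.filter fun z =>
    z.2 = 0 ∨ (z.1 ≠ 0 ∧ z.2 ≠ 0 ∧ (IsSquare z.1 ↔ IsSquare z.2))

/-! Let s be 1 on D and -1 off D. If s has total -1 and autocorrelation -1 at every nonzero shift,
then D is a difference set with the stated parameters. Writing e, d for the indicators of 0 in the
two fields and χ for the quadratic characters, s = χ_F χ_K + (1 + e)d - e, so its autocorrelation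
splits into nine products of one-variable sums (`sum_twinPrimePowerSign_add_mul`). The only deep one
is the autocorrelation of χ, a Jacobi sum; the mixed terms cancel because -1 is a square in exactly
one field. The GSEDF is then formal: a nonzero g is λ times a difference within D, hence k - λ times
a difference from D to its complement. -/

/-! ### Counting differences -/

open Finset in
theorem count_diffMultiset {G : Type*} [AddCommGroup G] [Fintype G] [DecidableEq G]
    (A B : Finset G) (g : G) :
    (diffMultiset A B).count g = #{z : G | z + g ∈ A ∧ z ∈ B} := by
  rw [diffMultiset, Multiset.count_map, ← Finset.filter_val, Finset.card_val]
  refine Finset.card_bij' (fun p _ => p.2) (fun z _ => (z + g, z)) ?_ ?_ ?_ ?_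
  · rintro ⟨x, y⟩ h
    simp only [mem_filter, mem_product, mem_univ, true_and] at h ⊢
    obtain ⟨⟨hx, hy⟩, rfl⟩ := h
    simpa using ⟨hx, hy⟩
  · intro z h
    simpa using h
  · rintro ⟨x, y⟩ h
    simp only [mem_filter, mem_product] at h
    obtain ⟨-, rfl⟩ := h
    simp
  · intro z _
    rfl

theorem count_nsmul_univ_sdiff_zero {G : Type*} [AddCommGroup G] [Fintype G] [DecidableEq G]
    (n : ℕ) (g : G) :
    (n • ((Finset.univ : Finset G) \ {0}).val).count g = if g = 0 then 0 else n := by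
  rw [Multiset.count_nsmul, Multiset.count_eq_of_nodup (Finset.nodup _)]
  by_cases h : g = 0 <;> simp [h, -Finset.sdiff_val]

theorem diffMultiset_eq_nsmul_iff {G : Type*} [AddCommGroup G] [Fintype G] [DecidableEq G]
    (A B : Finset G) (n : ℕ) :
    diffMultiset A B = n • ((Finset.univ : Finset G) \ {0}).val ↔
      ∀ g, (diffMultiset A B).count g = if g = 0 then 0 else n := by
  simp only [Multiset.ext, count_nsmul_univ_sdiff_zero]

theorem count_diffMultiset_neg {G : Type*} [AddCommGroup G] [Fintype G] [DecidableEq G]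
    (A B : Finset G) (g : G) :
    (diffMultiset A B).count (-g) = (diffMultiset B A).count g := by
  rw [count_diffMultiset, count_diffMultiset]
  refine Finset.card_bij' (fun z _ => z + -g) (fun z _ => z + g) ?_ ?_ ?_ ?_ <;>
    simp +contextual

-- For each x in D, the element x - g lies in exactly one of D and its complement.
open Finset in
theorem count_diffMultiset_self_add_compl {G : Type*} [AddCommGroup G] [Fintype G]
    [DecidableEq G] (D : Finset G) (g : G) :
    (diffMultiset D D).count g + (diffMultiset D Dᶜ).count g = #D := by
  rw [count_diffMultiset, count_diffMultiset, ← card_union_of_disjoint, ← filter_or]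
  · refine Finset.card_bij' (fun z _ => z + g) (fun z _ => z - g) ?_ ?_ ?_ ?_
    · intro z hz
      simp only [mem_filter, mem_univ, true_and] at hz
      tauto
    · intro z hz
      simp [hz, em]
    all_goals simp
  · rw [disjoint_filter]
    intro z _ h h'
    exact (mem_compl.1 h'.2) h.2

/-- A difference set and its complement form a generalized strong external difference family. -/
theorem IsDifferenceSet.isGSEDF_compl {G : Type*} [AddCommGroup G] [Fintype G] [DecidableEq G]
    {v k lam : ℕ} {D : Finset G} (h : IsDifferenceSet v k lam D) (hlt : lam < k) :
    IsGSEDF v 2 ![k, v - k] ![k - lam, k - lam] ![D, Dᶜ] := by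
  obtain ⟨hv, hk, -, hD⟩ := h
  have hcount (g : G) : (diffMultiset D Dᶜ).count g = if g = 0 then 0 else k - lam := by
    have h1 := count_diffMultiset_self_add_compl D g
    rw [hD, Multiset.count_add, count_nsmul_univ_sdiff_zero, Multiset.count_nsmul,
      Multiset.count_singleton, hk] at h1
    split_ifs at h1 ⊢ <;> omega
  have hcount' (g : G) : (diffMultiset Dᶜ D).count g = if g = 0 then 0 else k - lam := by
    rw [← count_diffMultiset_neg, hcount]
    simp
  have f0 : Finset.univ.filter (fun j : Fin 2 => j ≠ 0) = {1} := by decide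
  have f1 : Finset.univ.filter (fun j : Fin 2 => j ≠ 1) = {0} := by decide
  refine ⟨hv, ?_, ?_, ?_, ?_⟩
  · intro i
    fin_cases i <;> simpa using hlt
  · intro i j hij
    fin_cases i <;> fin_cases j <;>
      first | exact absurd rfl hij | exact disjoint_compl_right | exact disjoint_compl_left
  · intro i
    fin_cases i
    · exact hk
    · simp [Finset.card_compl, hv, hk]
  · intro i
    fin_cases i
    · simp only [Fin.zero_eta, f0, Finset.sum_singleton]
      exact (diffMultiset_eq_nsmul_iff _ _ _).2 hcount
    · simp only [Fin.mk_one, f1, Finset.sum_singleton]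
      exact (diffMultiset_eq_nsmul_iff _ _ _).2 hcount'

/-! ### Quadratic character sums -/

/-- The autocorrelation of the quadratic character at a nonzero shift. -/
theorem sum_quadraticChar_add_mul {F : Type*} [Field F] [Fintype F] [DecidableEq F]
    (hF : ringChar F ≠ 2) {u : F} (hu : u ≠ 0) :
    ∑ x, quadraticChar F (x + u) * quadraticChar F x = -1 := by
  have hJ := jacobiSum_nontrivial_inv (quadraticChar_ne_one hF)
  rw [(quadraticChar_isQuadratic F).inv, jacobiSum] at hJ
  have hneg : quadraticChar F (-1) * quadraticChar F (-1) = 1 := by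
    rw [← map_mul]; simp
  have husq : quadraticChar F u * quadraticChar F u = 1 := by
    rw [← sq, quadraticChar_sq_one hu]
  -- Replacing x by -ux turns the sum into χ(-1) J(χ, χ), and J(χ, χ) = -χ(-1).
  rw [← Equiv.sum_comp (Equiv.mulLeft₀ (-u) (neg_ne_zero.2 hu))]
  have hterm (x : F) : quadraticChar F (Equiv.mulLeft₀ (-u) (neg_ne_zero.2 hu) x + u) *
      quadraticChar F (Equiv.mulLeft₀ (-u) (neg_ne_zero.2 hu) x) =
      quadraticChar F (-1) * (quadraticChar F x * quadraticChar F (1 - x)) := by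
    have e1 : Equiv.mulLeft₀ (-u) (neg_ne_zero.2 hu) x + u = u * (1 - x) := by
      simp; ring
    have e2 : Equiv.mulLeft₀ (-u) (neg_ne_zero.2 hu) x = -1 * (u * x) := by
      simp
    rw [e1, e2]
    simp only [map_mul]
    linear_combination (quadraticChar F (-1) * quadraticChar F x * quadraticChar F (1 - x)) * husq
  simp only [hterm, ← Finset.mul_sum, hJ]
  linarith

theorem sum_quadraticChar_add_mul_eq_ite {F : Type*} [Field F] [Fintype F] [DecidableEq F]
    (hF : ringChar F ≠ 2) (u : F) :
    ∑ x, quadraticChar F (x + u) * quadraticChar F x =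
      (if u = 0 then (Fintype.card F : ℤ) else 0) - 1 := by
  split_ifs with h
  · subst h
    have (x : F) : quadraticChar F (x + 0) * quadraticChar F x = 1 - if x = 0 then 1 else 0 := by
      split_ifs with hx
      · simp [hx]
      · rw [add_zero, ← sq, quadraticChar_sq_one hx, sub_zero]
    simp only [this, Finset.sum_sub_distrib]
    simp
  · rw [sum_quadraticChar_add_mul hF h, zero_sub]

/-- Of two consecutive odd numbers, exactly one is 1 mod 4. -/
theorem quadraticChar_neg_one_mul_neg_one {F K : Type*} [Field F] [Fintype F] [DecidableEq F]
    [Field K] [Fintype K] [DecidableEq K] (hF : ringChar F ≠ 2) (hK : ringChar K ≠ 2)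
    (hodd : Odd (Fintype.card F)) (hcard : Fintype.card K = Fintype.card F + 2) :
    quadraticChar F (-1) * quadraticChar K (-1) = -1 := by
  rw [quadraticChar_neg_one hF, quadraticChar_neg_one hK, hcard]
  obtain ⟨m, hm⟩ := hodd
  rw [hm, ZMod.χ₄_nat_mod_four, ZMod.χ₄_nat_mod_four (2 * m + 1 + 2)]
  obtain h | h : (2 * m + 1) % 4 = 1 ∧ (2 * m + 1 + 2) % 4 = 3 ∨
      (2 * m + 1) % 4 = 3 ∧ (2 * m + 1 + 2) % 4 = 1 := by omega
  all_goals rw [h.1, h.2]; decide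

/-! ### The sign function and its autocorrelation -/

/-- The `±1`-valued function of the twin prime power set, as a sum of three products. -/
def twinPrimePowerSign (F K : Type*) [Field F] [Fintype F] [DecidableEq F]
    [Field K] [Fintype K] [DecidableEq K] (z : F × K) : ℤ :=
  quadraticChar F z.1 * quadraticChar K z.2
    + (1 + if z.1 = 0 then 1 else 0) * (if z.2 = 0 then 1 else 0)
    - if z.1 = 0 then 1 else 0

theorem twinPrimePowerSign_eq (F K : Type*) [Field F] [Fintype F] [DecidableEq F]
    [Field K] [Fintype K] [DecidableEq K] (z : F × K) :
    twinPrimePowerSign F K z = 2 * (if z ∈ twinPrimePowerSet F K then 1 else 0) - 1 := by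
  obtain ⟨x, y⟩ := z
  simp only [twinPrimePowerSign, twinPrimePowerSet, Finset.mem_filter, Finset.mem_univ, true_and]
  by_cases hx : x = 0 <;> by_cases hy : y = 0
  · simp [hx, hy]
  · simp [hx, hy]
  · simp [hx, hy]
  · have a := quadraticChar_apply (F := F) x
    have b := quadraticChar_apply (F := K) y
    rw [quadraticCharFun, if_neg hx] at a
    rw [quadraticCharFun, if_neg hy] at b
    rw [a, b]
    by_cases h1 : IsSquare x <;> by_cases h2 : IsSquare y <;> simp [hx, hy, h1, h2]

theorem sum_prod_mul {α β : Type*} [Fintype α] [Fintype β] (f : α → ℤ) (g : β → ℤ) :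
    ∑ z : α × β, f z.1 * g z.2 = (∑ x, f x) * ∑ y, g y := by
  rw [Fintype.sum_prod_type, Finset.sum_mul_sum]

theorem sum_twinPrimePowerSign (F K : Type*) [Field F] [Fintype F] [DecidableEq F]
    [Field K] [Fintype K] [DecidableEq K] (hF : ringChar F ≠ 2)
    (hcard : Fintype.card K = Fintype.card F + 2) :
    ∑ z, twinPrimePowerSign F K z = -1 := by
  have h3 : ∑ z : F × K, (if z.1 = 0 then 1 else 0 : ℤ) = Fintype.card K := by
    simpa using sum_prod_mul (fun x : F => (if x = 0 then 1 else 0 : ℤ)) (fun _ : K => 1)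
  simp only [twinPrimePowerSign, Finset.sum_add_distrib, Finset.sum_sub_distrib, h3]
  rw [sum_prod_mul (fun x => quadraticChar F x) (fun y => quadraticChar K y),
    sum_prod_mul (fun x : F => (1 + if x = 0 then 1 else 0 : ℤ))
      (fun y : K => (if y = 0 then 1 else 0 : ℤ)), quadraticChar_sum_zero hF]
  simp [Finset.sum_add_distrib, hcard]

theorem sum_twinPrimePowerSign_add_mul (F K : Type*) [Field F] [Fintype F] [DecidableEq F]
    [Field K] [Fintype K] [DecidableEq K] (hF : ringChar F ≠ 2) (hK : ringChar K ≠ 2)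
    (hodd : Odd (Fintype.card F)) (hcard : Fintype.card K = Fintype.card F + 2)
    {g : F × K} (hg : g ≠ 0) :
    ∑ z, twinPrimePowerSign F K (z + g) * twinPrimePowerSign F K z = -1 := by
  obtain ⟨u, w⟩ := g
  let a : F → ℤ := fun x => quadraticChar F x
  let b : K → ℤ := fun y => quadraticChar K y
  let e : F → ℤ := fun x => if x = 0 then 1 else 0
  let d : K → ℤ := fun y => if y = 0 then 1 else 0
  have hexpand (z : F × K) :
      twinPrimePowerSign F K (z + (u, w)) * twinPrimePowerSign F K z =
        (a (z.1 + u) * a z.1) * (b (z.2 + w) * b z.2)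
        + (a (z.1 + u) * (1 + e z.1)) * (b (z.2 + w) * d z.2)
        - (a (z.1 + u) * e z.1) * b (z.2 + w)
        + ((1 + e (z.1 + u)) * a z.1) * (d (z.2 + w) * b z.2)
        + ((1 + e (z.1 + u)) * (1 + e z.1)) * (d (z.2 + w) * d z.2)
        - ((1 + e (z.1 + u)) * e z.1) * d (z.2 + w)
        - (e (z.1 + u) * a z.1) * b z.2
        - (e (z.1 + u) * (1 + e z.1)) * d z.2
        + (e (z.1 + u) * e z.1) * (1 : K → ℤ) z.2 := by
    simp only [twinPrimePowerSign, Prod.fst_add, Prod.snd_add, a, b, e, d, Pi.one_apply]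
    ring
  have ha : ∑ x, a x = 0 := quadraticChar_sum_zero hF
  have hb : ∑ y, b y = 0 := quadraticChar_sum_zero hK
  have ha' : ∑ x, a (x + u) = 0 := by rw [← ha]; exact Equiv.sum_comp (Equiv.addRight u) a
  have hb' : ∑ y, b (y + w) = 0 := by rw [← hb]; exact Equiv.sum_comp (Equiv.addRight w) b
  have he : ∑ x, e x = 1 := by simp [e]
  have hd : ∑ y, d y = 1 := by simp [d]
  have he' : ∑ x, e (x + u) = 1 := by rw [← he]; exact Equiv.sum_comp (Equiv.addRight u) e
  have hd' : ∑ y, d (y + w) = 1 := by rw [← hd]; exact Equiv.sum_comp (Equiv.addRight w) d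
  have haa := sum_quadraticChar_add_mul_eq_ite hF u
  have hbb := sum_quadraticChar_add_mul_eq_ite hK w
  have hae : ∑ x, a (x + u) * e x = a u := by simp [e]
  have hbd : ∑ y, b (y + w) * d y = b w := by simp [d]
  have hea : ∑ x, e (x + u) * a x = a (-1) * a u := by
    simp only [a, ← map_mul]
    simp [e, add_eq_zero_iff_eq_neg]
  have hdb : ∑ y, d (y + w) * b y = b (-1) * b w := by
    simp only [b, ← map_mul]
    simp [d, add_eq_zero_iff_eq_neg]
  have hee : ∑ x, e (x + u) * e x = e u := by simp [e]
  have hdd : ∑ y, d (y + w) * d y = d w := by simp [d]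
  have hneg : a (-1) * b (-1) = -1 := quadraticChar_neg_one_mul_neg_one hF hK hodd hcard
  simp only [hexpand, Finset.sum_add_distrib, Finset.sum_sub_distrib]
  rw [sum_prod_mul (fun x => a (x + u) * a x) (fun y => b (y + w) * b y),
    sum_prod_mul (fun x => a (x + u) * (1 + e x)) (fun y => b (y + w) * d y),
    sum_prod_mul (fun x => a (x + u) * e x) (fun y => b (y + w)),
    sum_prod_mul (fun x => (1 + e (x + u)) * a x) (fun y => d (y + w) * b y),
    sum_prod_mul (fun x => (1 + e (x + u)) * (1 + e x)) (fun y => d (y + w) * d y),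
    sum_prod_mul (fun x => (1 + e (x + u)) * e x) (fun y => d (y + w)),
    sum_prod_mul (fun x => e (x + u) * a x) b,
    sum_prod_mul (fun x => e (x + u) * (1 + e x)) d,
    sum_prod_mul (fun x => e (x + u) * e x) 1]
  simp only [mul_add, add_mul, mul_one, one_mul, Finset.sum_add_distrib, Pi.one_apply,
    Finset.sum_const, Finset.card_univ, nsmul_eq_mul, ha, hb, ha', hb', he, hd, he', hd',
    hae, hbd, hea, hdb, hee, hdd]
  rw [haa, hbb, hcard]
  -- On the two axes the orders of the fields enter, and the total is -1 because they differ by 2.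
  -- Off the axes, what remains is 1 - 1 - 1 plus a(u)b(w)(1 + a(-1)b(-1)), which vanishes by
  -- `hneg`.
  by_cases hu : u = 0
  · have hw : w ≠ 0 := fun hw => hg (by rw [hu, hw]; rfl)
    simp [hu, hw, a, d, e]
    ring
  · by_cases hw : w = 0
    · simp [hu, hw, b, d, e]
      ring
    · simp [hu, hw, d, e]
      linear_combination (a u * b w) * hneg

theorem FiniteField.ringChar_ne_two_of_odd_card {F : Type*} [Field F] [Fintype F]
    (h : Odd (Fintype.card F)) : ringChar F ≠ 2 := fun h2 =>
  absurd (FiniteField.even_card_of_char_two h2) (by rw [Nat.odd_iff] at h; omega)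

open Finset in
/-- The twin prime power difference set. -/
theorem isDifferenceSet_twinPrimePowerSet (F K : Type*) [Field F] [Fintype F] [DecidableEq F]
    [Field K] [Fintype K] [DecidableEq K] {t : ℕ} (ht : 0 < t)
    (hodd : Odd (Fintype.card F)) (hcard : Fintype.card K = Fintype.card F + 2)
    (hv : Fintype.card F * Fintype.card K = 4 * t + 3) :
    IsDifferenceSet (4 * t + 3) (2 * t + 1) t (twinPrimePowerSet F K) := by
  have hF := FiniteField.ringChar_ne_two_of_odd_card hodd
  have hK : ringChar K ≠ 2 := FiniteField.ringChar_ne_two_of_odd_card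
    (by rw [hcard]; exact hodd.add_even even_two)
  have hG : Fintype.card (F × K) = 4 * t + 3 := by rw [Fintype.card_prod, hv]
  have hG' : (Fintype.card (F × K) : ℤ) = 4 * t + 3 := by exact_mod_cast hG
  set D := twinPrimePowerSet F K with hD
  let c : F × K → ℤ := fun z => if z ∈ D then 1 else 0
  have hsum := sum_twinPrimePowerSign F K hF hcard
  have hcsum : ∑ z, c z = #D := by simp [c]
  have hk : #D = 2 * t + 1 := by
    simp only [twinPrimePowerSign_eq, sum_sub_distrib, ← mul_sum, ← hD] at hsum
    change 2 * ∑ z, c z - _ = _ at hsum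
    rw [hcsum] at hsum
    simp only [sum_const, card_univ, nsmul_eq_mul, mul_one, hG'] at hsum
    omega
  refine ⟨hG, hk, ht, ?_⟩
  ext g
  rw [Multiset.count_add, count_nsmul_univ_sdiff_zero, Multiset.count_nsmul,
    Multiset.count_singleton, count_diffMultiset]
  by_cases hg : g = 0
  · simp [hg, hk]
  · have hcorr := sum_twinPrimePowerSign_add_mul F K hF hK hodd hcard hg
    have hcount : ∑ z, c (z + g) * c z = #{z : F × K | z + g ∈ D ∧ z ∈ D} := by
      simp only [c, ite_zero_mul_ite_zero, mul_one, sum_boole]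
    have hshift : ∑ z, c (z + g) = #D := by
      rw [← hcsum]; exact Equiv.sum_comp (Equiv.addRight g) c
    -- Summed over z, this gives 4N - 4k + v = -1 for the multiplicity N of g, so N = t.
    have hterm (z : F × K) : twinPrimePowerSign F K (z + g) * twinPrimePowerSign F K z =
        4 * (c (z + g) * c z) - 2 * c (z + g) - 2 * c z + 1 := by
      rw [twinPrimePowerSign_eq, twinPrimePowerSign_eq]
      change (2 * c (z + g) - 1) * (2 * c z - 1) = _
      ring
    simp only [hterm, sum_add_distrib, sum_sub_distrib, ← mul_sum, hcount, hshift, hcsum,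
      sum_const, card_univ, nsmul_eq_mul, mul_one, hG', hk] at hcorr
    push_cast at hcorr
    simp only [hg, if_false, mul_zero, zero_add]
    omega

theorem IsPrimePow.exists_finiteField {q : ℕ} (hq : IsPrimePow q) :
    ∃ (F : Type) (_ : Field F) (_ : Fintype F), Fintype.card F = q := by
  obtain ⟨p, n, hp, hn, rfl⟩ := hq
  have : Fact p.Prime := ⟨hp.nat_prime⟩
  let _ : Fintype (GaloisField p n) := Fintype.ofFinite _
  exact ⟨GaloisField p n, inferInstance, inferInstance, by
    rw [← Nat.card_eq_fintype_card, GaloisField.card p n hn.ne']⟩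

theorem mainTheorem8 (q v : ℕ) (hq : IsPrimePow q) (hq_odd : Odd q)
    (hq2 : IsPrimePow (q + 2)) (hv : v = q * (q + 2)) :
    4 ∣ v + 1 ∧
    (∃ (G : Type) (_ : AddCommGroup G) (_ : Fintype G) (_ : DecidableEq G)
        (D : Fin 2 → Finset G),
      IsGSEDF v 2 ![(v - 1) / 2, (v + 1) / 2] ![(v + 1) / 4, (v + 1) / 4] D) ∧
    (∀ (F K : Type*) [Field F] [Fintype F] [DecidableEq F]
        [Field K] [Fintype K] [DecidableEq K],
      Fintype.card F = q → Fintype.card K = q + 2 →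
      IsDifferenceSet v ((v - 1) / 2) ((v - 3) / 4) (twinPrimePowerSet F K) ∧
      IsGSEDF v 2 ![(v - 1) / 2, (v + 1) / 2] ![(v + 1) / 4, (v + 1) / 4]
        ![twinPrimePowerSet F K, (twinPrimePowerSet F K)ᶜ]) := by
  obtain ⟨t, ht, hvt⟩ : ∃ t, 0 < t ∧ v = 4 * t + 3 := by
    obtain ⟨m, rfl⟩ := hq_odd
    have hm : 0 < m := by
      rcases Nat.eq_zero_or_pos m with rfl | hm
      · exact absurd hq.one_lt (by simp)
      · exact hm
    -- (2m + 1)(2m + 3) = 4(m² + 2m) + 3; m > 0 makes λ = t positive.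
    exact ⟨m * m + 2 * m, by positivity, by rw [hv]; ring⟩
  have h1 : (v - 1) / 2 = 2 * t + 1 := by omega
  have h2 : (v + 1) / 2 = 4 * t + 3 - (2 * t + 1) := by omega
  have h3 : (v + 1) / 4 = 2 * t + 1 - t := by omega
  have h4 : (v - 3) / 4 = t := by omega
  refine ⟨by omega, ?_, ?_⟩
  · obtain ⟨F, _, _, hF⟩ := hq.exists_finiteField
    obtain ⟨K, _, _, hK⟩ := hq2.exists_finiteField
    classical
    have hD := isDifferenceSet_twinPrimePowerSet F K ht (hF ▸ hq_odd) (by rw [hF, hK])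
      (by rw [hF, hK, ← hv, hvt])
    refine ⟨F × K, inferInstance, inferInstance, inferInstance,
      ![twinPrimePowerSet F K, (twinPrimePowerSet F K)ᶜ], ?_⟩
    rw [h1, h2, h3, hvt]
    exact hD.isGSEDF_compl (by omega)
  · intro F K _ _ _ _ _ _ hF hK
    have hD := isDifferenceSet_twinPrimePowerSet F K ht (hF ▸ hq_odd) (by rw [hF, hK])
      (by rw [hF, hK, ← hv, hvt])
    rw [h1, h2, h3, h4, hvt]
    exact ⟨hD, hD.isGSEDF_compl (by omega)⟩
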